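/- Conventions. An \emph{ideal} of subsets of a set $S$ is a family of subsets of $S$ that contains all finite subsets of $S$ and is closed under subsets and finite unions; write $A \subset^* B$ if $A \setminus B$ is finite. An ideal $\mathcal{I}$ of countable subsets of $S$ is a \emph{P-ideal} if for all $\{A_n : n \in \omega\} \subset \mathcal{I}$ there is $B \in \mathcal{I}$ with $A_n \subset^* B$ for every $n$. The \emph{P-ideal dichotomy} $\mathrm{PID}$ says: for every set $S$ and every P-ideal $\mathcal{I}$ of countable subsets of $S$, either there is an uncountable $X \subset S$ all of whose countable subsets belong to $\mathcal{I}$, or $S = \bigcup_{n \in \omega} X_n$ where, for each $n$, $X_n \cap A$ is finite for every $A \in \mathcal{I}$. A \emph{directed set} is a nonempty partially ordered set in which any two elements have an upper bound. A subset is \emph{bounded} if it has an upper bound, and $X \subset D$ is \emph{cofinal} in $D$ if each $y \in D$ satisfies $y \leq x$ for some $x \in X$. For directed sets $D, E$, write $D \leq_T E$ if there is a map $f : D \to E$ that sends every unbounded subset of $D$ to an unbounded subset of $E$; $D$ and $E$ have the same \emph{cofinal (Tukey) type}, $D \equiv_T E$, if $D \leq_T E$ and $E \leq_T D$. The product $\omega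 \times \omega_1$ carries the product order, and $[\omega_1]^{<\omega}$, the set of finite subsets of $\omega_1$, is ordered by inclusion. $\mathfrak{b}$ is the least size of a family $F \subset \omega^\omega$ for which there is no $g \in \omega^\omega$ such that for every $f \in F$, $f(n) < g(n)$ for all but finitely many $n$. A subset $X$ of a directed set $D$ is \emph{pseudobounded} if every countably infinite $A \subset X$ has an infinite subset that is bounded in $D$; $D$ is \emph{$\sigma$-pseudobounded} if it is the union of countably many pseudobounded sets. An \emph{ideal on $\omega$} is an ideal $\mathcal{I}$ of subsets of $\omega$ with $\omega \notin \mathcal{I}$, ordered by inclusion; it is \emph{tall} if every infinite subset of $\omega$ has an infinite subset in $\mathcal{I}$, and it is $F_\sigma$ if it is a countable union of closed subsets of $\mathcal{P}(\omega) \cong 2^\omega$ with the product topology. $\mathrm{cof}(\mathcal{F}_\sigma)$ is the least cardinal $\kappa$ such that there are a tall, $\sigma$-pseudobounded $F_\sigma$ ideal $\mathcal{I}$ on $\omega$ and a directed cofinal $X \subset \mathcal{I}$ with $|X| = \kappa$. \textbf{Theorem.} Assume $\mathrm{PID}$. The following are equivalent. (1) $\min\{\mathfrak{b}, \mathrm{cof}(\mathcal{F}_\sigma)\}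 > \omega_1$. (2) $1$, $\omega$, $\omega_1$, $\omega \times \omega_1$ and $[\omega_1]^{<\omega}$ are the only cofinal types of directed sets of size at most $\aleph_1$; that is, every directed set of size at most $\aleph_1$ is Tukey equivalent to one of these five. -/

import Mathlib

universe u v

noncomputable section

namespace FiveTypes

open Set

/-! ### Tukey reducibility -/

/-- A map between preorders is a Tukey map if it sends unbounded sets (sets without an upper bound)
to unbounded sets. -/
def IsTukeyMap {D : Type u} {E : Type v} [Preorder D] [Preorder E] (f : D → E) : Prop :=
  ∀ X : Set D, ¬ BddAbove X → ¬ BddAbove (f '' X)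

/-- `D ≤_T E`: there is a Tukey map from `D` to `E`. -/
def TukeyLE (D : Type u) (E : Type v) [Preorder D] [Preorder E] : Prop :=
  ∃ f : D → E, IsTukeyMap f

/-- `D ≡_T E`: `D` and `E` have the same cofinal (Tukey) type. -/
def TukeyEquiv (D : Type u) (E : Type v) [Preorder D] [Preorder E] : Prop :=
  TukeyLE D E ∧ TukeyLE E D

/-- The set of countable ordinals, with its usual well-order. -/
abbrev Omega1 : Type := (Ordinal.omega.{0} 1).ToType

/-- Each of the cofinal types of directed sets of size at most `ℵ₁` is one of
`1`, `ω`, `ω₁`, `ω × ω₁` (product order) and `[ω₁]^{<ω}` (finite sets, ordered by inclusion). -/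
def OnlyFiveCofinalTypes : Prop :=
  ∀ (D : Type u) [PartialOrder D] [Nonempty D] [IsDirectedOrder D],
    Cardinal.mk D ≤ Cardinal.aleph 1 →
      TukeyEquiv D Unit ∨ TukeyEquiv D ℕ ∨ TukeyEquiv D Omega1 ∨
        TukeyEquiv D (ℕ × Omega1) ∨ TukeyEquiv D (Finset Omega1)

/-! ### The P-ideal dichotomy -/

/-- `I` is a P-ideal of countable subsets of `S`: an ideal of subsets of `S` (closed under subsets
and finite unions) which contains all finite sets, all of whose members are countable, and which is
such that any countably many members are almost contained in a single member. -/
structure IsPIdeal {S : Type u} (I : Order.Ideal (Set S)) : Prop where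
  countable_of_mem : ∀ A ∈ I, A.Countable
  mem_of_finite : ∀ A : Set S, A.Finite → A ∈ I
  exists_almost_superset : ∀ A : ℕ → Set S, (∀ n, A n ∈ I) → ∃ B ∈ I, ∀ n, (A n \ B).Finite

/-- The P-ideal dichotomy: for every P-ideal `I` of countable subsets of a set `S`, either there is
an uncountable subset of `S` all of whose countable subsets are in `I`, or `S` is the union of
countably many sets, each of which has finite intersection with every member of `I`. -/
def PID : Prop :=
  ∀ (S : Type u) (I : Order.Ideal (Set S)), IsPIdeal I →
    (∃ X : Set S, ¬ X.Countable ∧ ∀ A ⊆ X, A.Countable → A ∈ I) ∨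
    (∃ X : ℕ → Set S, (⋃ n, X n) = univ ∧ ∀ n, ∀ A ∈ I, (A ∩ X n).Finite)

/-! ### The bounding number -/

/-- `f <* g`: `f n < g n` for all but finitely many `n`. -/
def EventuallyLess (f g : ℕ → ℕ) : Prop := {n | ¬ f n < g n}.Finite

/-- The bounding number `𝔟`: the least size of a family of functions `ω → ω` which is not bounded
with respect to `<*`. -/
def boundingNumber : Cardinal.{0} :=
  sInf {κ | ∃ F : Set (ℕ → ℕ), (¬ ∃ g : ℕ → ℕ, ∀ f ∈ F, EventuallyLess f g) ∧ Cardinal.mk F = κ}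

/-! ### Ideals on `ω` and the cardinal `cof(𝓕_σ)` -/

/-- `X` is pseudobounded in `D`: each countably infinite subset of `X` has an infinite subset which
is bounded in `D`. -/
def IsPseudobounded {D : Type u} [Preorder D] (X : Set D) : Prop :=
  ∀ A ⊆ X, A.Infinite → A.Countable → ∃ B ⊆ A, B.Infinite ∧ BddAbove B

/-- `D` is the union of countably many pseudobounded sets. -/
def IsSigmaPseudobounded (D : Type u) [Preorder D] : Prop :=
  ∃ X : ℕ → Set D, (⋃ n, X n) = univ ∧ ∀ n, IsPseudobounded (X n)

/-- An ideal on `ω`: a proper ideal of subsets of `ω` which contains all finite sets. -/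
structure IsIdealOnOmega (I : Order.Ideal (Set ℕ)) : Prop where
  univ_notMem : univ ∉ I
  mem_of_finite : ∀ A : Set ℕ, A.Finite → A ∈ I

/-- Each infinite subset of `ω` has an infinite subset which is in the ideal. -/
def IsTall (I : Order.Ideal (Set ℕ)) : Prop :=
  ∀ A : Set ℕ, A.Infinite → ∃ B ∈ I, B ⊆ A ∧ B.Infinite

/-- The ideal is an `F_σ` subset of `𝓟(ω)`, which is identified with the Cantor space `ω → 2`
(product topology) through characteristic functions. -/
def IsFSigma (I : Order.Ideal (Set ℕ)) : Prop :=
  ∃ K : ℕ → Set (ℕ → Bool), (∀ n, IsClosed (K n)) ∧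
    {x : ℕ → Bool | {k | x k = true} ∈ I} = ⋃ n, K n

/-- `cof(𝓕_σ)`: the least size of a directed cofinal subset of a tall, `σ`-pseudobounded `F_σ`
ideal on `ω` (ordered by inclusion). -/
def cofFSigma : Cardinal.{0} :=
  sInf {κ | ∃ I : Order.Ideal (Set ℕ),
    IsIdealOnOmega I ∧ IsTall I ∧ IsSigmaPseudobounded I ∧ IsFSigma I ∧
      ∃ X : Set I, DirectedOn (· ≤ ·) X ∧ IsCofinal X ∧ Cardinal.mk X = κ}

end FiveTypes

end

universe w

namespace FiveTypes

open Set Filter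

/-! ### Countable ordinals -/

/-! Below `ω × ω₁`, a directed set `D` of size at most `ℵ₁` has one of the first four types
(`four_types_of_tukeyLE`), and `D` lies there as soon as it is covered by countably many sets whose
countable subsets are bounded (`tukeyLE_prod_of_cover`).

(1) to (2): since `ℵ₁ < 𝔟`, the countable sets meeting every principal down-set of `D` in a finite
set form a P-ideal. PID applied to it gives either `ℵ₁` elements only finitely many of which lie
below any given one, so that `[ω₁]^{<ω} ≤_T D`, or a cover of `D` by countably many pseudobounded
sets (`finset_tukeyLE_or_isSigmaPseudobounded`). In the latter case, a countable unbounded subset of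
a pseudobounded set would trace on `ω` a tall, `σ`-pseudobounded `F_σ` ideal with cofinality at most
`ℵ₁`, against `ℵ₁ < cof(𝓕_σ)` (`IsPseudobounded.bddAbove_of_countable`). Hence `D ≤_T ω × ω₁`.

(2) to (1): if either cardinal were at most `ℵ₁`, there would be a directed set of size at most `ℵ₁`
in which every uncountable set has an infinite bounded subset, which excludes `[ω₁]^{<ω}`, but which
has no cover as above. For `cof(𝓕_σ)` it is a cofinal subset of a tall ideal; for `𝔟` it is an
unbounded scale of monotone functions under everywhere domination. -/

theorem mk_omega1 : Cardinal.mk Omega1 = Cardinal.aleph 1 := by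
  rw [Cardinal.mk_toType, Ordinal.card_omega]

instance omega1_uncountable : Uncountable Omega1 := by
  rw [← Cardinal.aleph0_lt_mk_iff, mk_omega1]
  exact Cardinal.aleph0_lt_aleph_one

theorem countable_Iio_omega1 (a : Omega1) : (Iio a).Countable := by
  have key : ∀ o : Ordinal.{0}, o = (Cardinal.aleph 1).ord → ∀ a : o.ToType,
      Cardinal.mk (Iio a) < Cardinal.aleph 1 := by
    rintro o rfl a
    exact (Cardinal.mk_Iio_lt a (by simp)).trans_eq (by simp)
  have h := key _ (Cardinal.ord_aleph 1).symm a
  rw [← Cardinal.succ_aleph0, Order.lt_succ_iff] at h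
  exact Cardinal.le_aleph0_iff_set_countable.1 h

theorem countable_Iic_omega1 (a : Omega1) : (Iic a).Countable := by
  rw [← Iio_insert]
  exact (countable_Iio_omega1 a).insert a

theorem bddAbove_omega1_iff {A : Set Omega1} : BddAbove A ↔ A.Countable := by
  constructor
  · rintro ⟨b, hb⟩
    exact (countable_Iic_omega1 b).mono fun a ha => hb ha
  · intro hA
    by_contra h
    have : (univ : Set Omega1) ⊆ ⋃ a ∈ A, Iio a := by
      intro b _
      rw [not_bddAbove_iff] at h
      obtain ⟨a, ha, hab⟩ := h b
      exact mem_biUnion ha hab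
    exact not_countable_univ
      ((hA.biUnion fun a _ => countable_Iio_omega1 a).mono this)

theorem exists_surjective_omega1 {D : Type w} [Nonempty D]
    (h : Cardinal.mk D ≤ Cardinal.aleph 1) : ∃ f : Omega1 → D, Function.Surjective f := by
  have : Nonempty (D ↪ Omega1) := by
    rw [← Cardinal.lift_mk_le', mk_omega1, Cardinal.lift_aleph, Ordinal.lift_one]
    calc _ ≤ Cardinal.lift.{0} (Cardinal.aleph.{w} 1) := Cardinal.lift_le.2 h
      _ = _ := by simp
  obtain ⟨e⟩ := this
  exact ⟨Function.invFun e, Function.invFun_surjective e.injective⟩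

/-! ### Tukey reductions -/

section Tukey

variable {D E F : Type*} [Preorder D] [Preorder E] [Preorder F]

theorem TukeyLE.of_bddAbove (f : D → E) (h : ∀ X : Set D, BddAbove (f '' X) → BddAbove X) :
    TukeyLE D E :=
  ⟨f, fun X hX hb => hX (h X hb)⟩

theorem IsTukeyMap.bddAbove {f : D → E} (hf : IsTukeyMap f) {X : Set D}
    (h : BddAbove (f '' X)) : BddAbove X :=
  by_contra fun hX => hf X hX h

theorem TukeyLE.trans (h : TukeyLE D E) (h' : TukeyLE E F) : TukeyLE D F := by
  obtain ⟨f, hf⟩ := h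
  obtain ⟨g, hg⟩ := h'
  refine TukeyLE.of_bddAbove (g ∘ f) fun X hX => hf.bddAbove (hg.bddAbove ?_)
  rwa [← image_comp]

theorem TukeyLE.to_unit (h : BddAbove (univ : Set D)) : TukeyLE D Unit :=
  TukeyLE.of_bddAbove (fun _ => ()) fun _ _ => h.mono (subset_univ _)

theorem TukeyLE.from_unit [Nonempty D] : TukeyLE Unit D :=
  TukeyLE.of_bddAbove (fun _ => Classical.arbitrary D) fun _ _ => ⟨(), fun _ _ => le_rfl⟩

theorem TukeyLE.prod_left [Nonempty E] : TukeyLE D (D × E) := by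
  refine TukeyLE.of_bddAbove (fun d => (d, Classical.arbitrary E)) ?_
  rintro X ⟨⟨d, e⟩, h⟩
  exact ⟨d, fun x hx => (h (mem_image_of_mem _ hx)).1⟩

theorem TukeyLE.prod_right [Nonempty E] : TukeyLE D (E × D) := by
  refine TukeyLE.of_bddAbove (fun d => (Classical.arbitrary E, d)) ?_
  rintro X ⟨⟨e, d⟩, h⟩
  exact ⟨d, fun x hx => (h (mem_image_of_mem _ hx)).2⟩

theorem TukeyLE.prod_le [IsDirectedOrder F] (h : TukeyLE D F) (h' : TukeyLE E F) :
    TukeyLE (D × E) F := by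
  obtain ⟨f, hf⟩ := h
  obtain ⟨g, hg⟩ := h'
  choose s hs₁ hs₂ using fun p : F × F => exists_ge_ge p.1 p.2
  refine TukeyLE.of_bddAbove (fun p => s (f p.1, g p.2)) ?_
  rintro X ⟨b, hb⟩
  have h₁ : BddAbove (Prod.fst '' X) := by
    refine hf.bddAbove ⟨b, ?_⟩
    rintro _ ⟨_, ⟨p, hp, rfl⟩, rfl⟩
    exact (hs₁ (f p.1, g p.2)).trans (hb (mem_image_of_mem _ hp))
  have h₂ : BddAbove (Prod.snd '' X) := by
    refine hg.bddAbove ⟨b, ?_⟩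
    rintro _ ⟨_, ⟨p, hp, rfl⟩, rfl⟩
    exact (hs₂ (f p.1, g p.2)).trans (hb (mem_image_of_mem _ hp))
  exact bddAbove_prod.2 ⟨h₁, h₂⟩

/-- As `ψ '' Iio β` is not cofinal, `f β` can be chosen below none of its members. A bound `ψ α` for
`f '' X` then keeps `X` below `α`. -/
theorem tukeyLE_omega1 {ψ : Omega1 → D} (hψ : Function.Surjective ψ)
    (h : ∀ C : Set D, C.Countable → ¬ IsCofinal C) : TukeyLE Omega1 D := by
  have : ∀ β, ∃ d, ∀ α < β, ¬ d ≤ ψ α := fun β => by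
    have := h _ ((countable_Iio_omega1 β).image ψ)
    unfold IsCofinal at this
    push Not at this
    obtain ⟨d, hd⟩ := this
    exact ⟨d, fun α hα => hd _ (mem_image_of_mem _ hα)⟩
  choose f hf using this
  refine TukeyLE.of_bddAbove f fun X ⟨d, hd⟩ => ?_
  obtain ⟨α, rfl⟩ := hψ d
  exact ⟨α, fun β hβ => not_lt.1 fun hlt => hf β α hlt (hd (mem_image_of_mem _ hβ))⟩

theorem tukeyLE_to_omega1 {ψ : Omega1 → D} (hψ : Function.Surjective ψ)
    (h : ∀ C : Set D, C.Countable → BddAbove C) : TukeyLE D Omega1 := by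
  refine TukeyLE.of_bddAbove (Function.surjInv hψ) fun X hX => h X ?_
  rw [bddAbove_omega1_iff] at hX
  exact countable_of_injective_of_countable_image (Function.injective_surjInv hψ).injOn hX

theorem exists_cover_of_tukeyLE_prod (h : TukeyLE D (ℕ × Omega1)) :
    ∃ P : ℕ → Set D, (⋃ n, P n) = univ ∧ ∀ n, ∀ A ⊆ P n, A.Countable → BddAbove A := by
  obtain ⟨f, hf⟩ := h
  refine ⟨fun n => {d | (f d).1 = n}, by ext; simp, fun n A hA hc => hf.bddAbove ?_⟩
  refine bddAbove_prod.2 ⟨⟨n, ?_⟩, bddAbove_omega1_iff.2 ((hc.image _).image _)⟩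
  rintro _ ⟨_, ⟨d, hd, rfl⟩, rfl⟩
  exact (hA hd).le

/-- Infinitely many singletons have no common finite superset, so `f` restricted to singletons is
finite-to-one and its range serves as `Y`. -/
theorem exists_uncountable_of_finset_tukeyLE (h : TukeyLE (Finset Omega1) D) :
    ∃ Y : Set D, ¬ Y.Countable ∧ ∀ A ⊆ Y, A.Infinite → ¬ BddAbove A := by
  obtain ⟨f, hf⟩ := h
  have hfin : ∀ S : Set Omega1, BddAbove ((fun α => f {α}) '' S) → S.Finite := fun S hS => by
    have : BddAbove ((fun α : Omega1 => ({α} : Finset Omega1)) '' S) := by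
      refine hf.bddAbove ?_
      rwa [← image_comp]
    obtain ⟨F, hF⟩ := this
    exact F.finite_toSet.subset fun α hα =>
      Finset.singleton_subset_iff.1 (hF (mem_image_of_mem _ hα))
  refine ⟨range fun α => f {α}, fun hc => ?_, fun A hA hinf hb => hinf ?_⟩
  · have : (univ : Set Omega1) ⊆ ⋃ d ∈ range (fun α => f {α}), {α | f {α} = d} := fun α _ =>
      mem_biUnion (mem_range_self α) rfl
    refine not_countable_univ ((hc.biUnion fun d _ => Finite.countable (hfin _ ⟨d, ?_⟩)).mono this)
    rintro _ ⟨α, hα, rfl⟩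
    exact le_of_eq hα
  · have h₂ : (fun α => f {α}) '' ((fun α => f {α}) ⁻¹' A) = A := image_preimage_eq_of_subset hA
    rw [← h₂]
    exact (hfin _ (h₂.symm ▸ hb)).image _

variable [IsDirectedOrder D] [Nonempty D]

theorem bddAbove_image_Iic (a : ℕ → D) (n : ℕ) : BddAbove (a '' Iic n) :=
  ((finite_Iic n).image a).bddAbove

theorem tukeyLE_nat {A : Set D} (hA : A.Countable) (hb : ¬ BddAbove A) : TukeyLE ℕ D := by
  have hne : A.Nonempty := by
    by_contra h
    rw [not_nonempty_iff_eq_empty] at h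
    exact hb (h ▸ bddAbove_empty)
  obtain ⟨a, rfl⟩ := hA.exists_eq_range hne
  choose b hbn using fun n => bddAbove_image_Iic a n
  refine TukeyLE.of_bddAbove b fun X ⟨d, hd⟩ => ?_
  by_contra hX
  refine hb ⟨d, ?_⟩
  rintro _ ⟨k, rfl⟩
  rw [not_bddAbove_iff] at hX
  obtain ⟨n, hn, hkn⟩ := hX k
  exact (hbn n (mem_image_of_mem _ hkn.le)).trans (hd (mem_image_of_mem _ hn))

theorem tukeyLE_to_nat {C : Set D} (hC : C.Countable) (hcof : IsCofinal C) : TukeyLE D ℕ := by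
  have hne : C.Nonempty := (hcof (Classical.arbitrary D)).imp fun _ h => h.1
  obtain ⟨c, rfl⟩ := hC.exists_eq_range hne
  have : ∀ d, ∃ n, d ≤ c n := fun d => by
    obtain ⟨_, ⟨n, rfl⟩, h⟩ := hcof d
    exact ⟨n, h⟩
  choose f hf using this
  refine TukeyLE.of_bddAbove f fun X ⟨N, hN⟩ => ?_
  obtain ⟨d, hd⟩ := bddAbove_image_Iic c N
  refine ⟨d, fun x hx => (hf x).trans (hd (mem_image_of_mem _ ?_))⟩
  exact hN (mem_image_of_mem _ hx)

theorem tukeyLE_finset {ψ : Omega1 → D} (hψ : Function.Surjective ψ) :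
    TukeyLE D (Finset Omega1) := by
  refine TukeyLE.of_bddAbove (fun d => {Function.surjInv hψ d}) fun X ⟨F, hF⟩ => ?_
  have : X ⊆ ψ '' F := fun x hx => by
    refine ⟨Function.surjInv hψ x, ?_, Function.surjInv_eq hψ x⟩
    exact Finset.singleton_subset_iff.1 (hF (mem_image_of_mem _ hx))
  exact ((F.finite_toSet.image ψ).subset this).bddAbove

theorem finset_tukeyLE {x : Omega1 → D}
    (hx : ∀ d, {α | x α ≤ d}.Finite) : TukeyLE (Finset Omega1) D := by
  choose f hf using fun F : Finset Omega1 => (F.finite_toSet.image x).bddAbove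
  refine TukeyLE.of_bddAbove f fun X ⟨d, hd⟩ => ⟨(hx d).toFinset, fun F hF α hα => ?_⟩
  rw [Finite.mem_toFinset]
  exact (hf F (mem_image_of_mem _ hα)).trans (hd (mem_image_of_mem _ hF))

/-- A directed set of size at most `ℵ₁` below `ω × ω₁` is of one of the four types other than
`[ω₁]^{<ω}`. -/
theorem four_types_of_tukeyLE {ψ : Omega1 → D} (hψ : Function.Surjective ψ)
    (h : TukeyLE D (ℕ × Omega1)) :
    TukeyEquiv D Unit ∨ TukeyEquiv D ℕ ∨ TukeyEquiv D Omega1 ∨ TukeyEquiv D (ℕ × Omega1) := by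
  -- Two questions separate the four types: whether some countable set is unbounded, and whether
  -- some countable set is cofinal.
  by_cases hunb : ∃ A : Set D, A.Countable ∧ ¬ BddAbove A
  · obtain ⟨A, hA, hAb⟩ := hunb
    by_cases hcof : ∃ C : Set D, C.Countable ∧ IsCofinal C
    · obtain ⟨C, hC, hCc⟩ := hcof
      exact Or.inr (Or.inl ⟨tukeyLE_to_nat hC hCc, tukeyLE_nat hA hAb⟩)
    · push Not at hcof
      exact Or.inr (Or.inr (Or.inr ⟨h, (tukeyLE_nat hA hAb).prod_le (tukeyLE_omega1 hψ hcof)⟩))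
  · push Not at hunb
    by_cases hcof : ∃ C : Set D, C.Countable ∧ IsCofinal C
    · obtain ⟨C, hC, hCc⟩ := hcof
      obtain ⟨b, hb⟩ := hunb C hC
      refine Or.inl ⟨TukeyLE.to_unit ⟨b, fun d _ => ?_⟩, TukeyLE.from_unit⟩
      obtain ⟨c, hc, hdc⟩ := hCc d
      exact hdc.trans (hb hc)
    · push Not at hcof
      exact Or.inr (Or.inr (Or.inl ⟨tukeyLE_to_omega1 hψ hunb, tukeyLE_omega1 hψ hcof⟩))

/-- A directed set of size at most `ℵ₁` which is covered by countably many sets whose countable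
subsets are bounded is Tukey below `ω × ω₁`. -/
theorem tukeyLE_prod_of_cover {ψ : Omega1 → D} (hψ : Function.Surjective ψ)
    {P : ℕ → Set D} (hP : (⋃ n, P n) = univ)
    (hb : ∀ n, ∀ A ⊆ P n, A.Countable → BddAbove A) : TukeyLE D (ℕ × Omega1) := by
  have : ∀ d, ∃ n, d ∈ P n := fun d => mem_iUnion.1 (hP ▸ mem_univ d)
  choose r hr using this
  refine TukeyLE.of_bddAbove (fun d => (r d, Function.surjInv hψ d)) ?_
  rintro X ⟨⟨N, β⟩, h⟩
  have hX : X.Countable := by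
    refine countable_of_injective_of_countable_image (Function.injective_surjInv hψ).injOn
      (bddAbove_omega1_iff.1 ⟨β, ?_⟩)
    rintro _ ⟨d, hd, rfl⟩
    exact (h (mem_image_of_mem _ hd)).2
  have hsub : X ⊆ ⋃ i ∈ Iic N, (X ∩ P i) := fun d hd =>
    mem_biUnion (h (mem_image_of_mem _ hd)).1 ⟨hd, hr d⟩
  refine BddAbove.mono hsub ((finite_Iic N).bddAbove_biUnion.2 fun i _ => ?_)
  exact hb i _ inter_subset_right (hX.mono inter_subset_left)

end Tukey

/-! ### The dichotomy for directed sets of size `ℵ₁` -/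

/-- A family of subsets which contains `∅` and is closed under subsets and unions, as an ideal. -/
def idealOfUnion {S : Type w} (P : Set S → Prop) (h0 : P ∅) (hmono : ∀ A B, A ⊆ B → P B → P A)
    (hunion : ∀ A B, P A → P B → P (A ∪ B)) : Order.Ideal (Set S) where
  carrier := {A | P A}
  lower' := fun B A hAB hB => hmono A B hAB hB
  nonempty' := ⟨∅, h0⟩
  directed' := fun A hA B hB => ⟨A ∪ B, hunion A B hA hB, subset_union_left, subset_union_right⟩

theorem mem_idealOfUnion {S : Type w} {P : Set S → Prop} {h0 hmono hunion} {A : Set S} :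
    A ∈ idealOfUnion P h0 hmono hunion ↔ P A := Iff.rfl

theorem exists_dominating {ι : Type} (hι : Cardinal.mk ι < boundingNumber) (f : ι → ℕ → ℕ) :
    ∃ g : ℕ → ℕ, ∀ i, EventuallyLess (f i) g := by
  by_contra h
  have h₁ : boundingNumber ≤ Cardinal.mk (range f) :=
    csInf_le (OrderBot.bddBelow _) ⟨range f, by simpa using h, rfl⟩
  exact absurd (h₁.trans Cardinal.mk_range_le) (not_le.2 hι)

/-- The ideal of all countable sets which are orthogonal to a family of sets `T i`. -/
def orthogonalIdeal {S : Type w} {ι : Type} (T : ι → Set S) : Order.Ideal (Set S) :=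
  idealOfUnion (fun A => A.Countable ∧ ∀ i, (A ∩ T i).Finite)
    ⟨countable_empty, fun i => by simp⟩
    (fun _ _ hAB hB => ⟨hB.1.mono hAB, fun i => (hB.2 i).subset (inter_subset_inter_left _ hAB)⟩)
    (fun A B hA hB => ⟨hA.1.union hB.1, fun i => by
      rw [union_inter_distrib_right]
      exact (hA.2 i).union (hB.2 i)⟩)

/-- With the countable union enumerated by `c`, each `i` yields a function `f i` bounding the codes
in `A n ∩ T i`. One `g` dominates all `f i`; removing from each `A n` the finitely many points with
code below `g n` leaves a union still orthogonal to every `T i`. -/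
theorem isPIdeal_orthogonalIdeal {S : Type w} {ι : Type} (hι : Cardinal.mk ι < boundingNumber)
    (T : ι → Set S) : IsPIdeal (orthogonalIdeal T) where
  countable_of_mem A hA := hA.1
  mem_of_finite A hA := ⟨hA.countable, fun i => hA.subset inter_subset_left⟩
  exists_almost_superset A hA := by
    have hc : (⋃ n, A n).Countable := countable_iUnion fun n => (hA n).1
    obtain ⟨c, hcinj⟩ := countable_iff_exists_injOn.1 hc
    have hb : ∀ i n, ∃ m, ∀ s ∈ A n ∩ T i, c s ≤ m := fun i n => by
      obtain ⟨m, hm⟩ := (((hA n).2 i).image c).bddAbove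
      exact ⟨m, fun s hs => hm (mem_image_of_mem _ hs)⟩
    choose f hf using hb
    obtain ⟨g, hg⟩ := exists_dominating hι f
    refine ⟨{s | ∃ n, s ∈ A n ∧ g n ≤ c s}, ⟨hc.mono ?_, fun i => ?_⟩, fun n => ?_⟩
    · rintro s ⟨n, hn, -⟩
      exact mem_iUnion.2 ⟨n, hn⟩
    · refine ((hg i).biUnion fun n _ => (hA n).2 i).subset ?_
      rintro s ⟨⟨n, hn, hgn⟩, hs⟩
      exact mem_biUnion (not_lt.2 ((hf i n s ⟨hn, hs⟩).trans' hgn)) ⟨hn, hs⟩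
    · have hinj : InjOn c (A n) := hcinj.mono (subset_iUnion A n)
      refine Finite.of_finite_image ((finite_Iio (g n)).subset ?_) (hinj.mono sdiff_subset)
      rintro _ ⟨s, ⟨hs, hns⟩, rfl⟩
      by_contra hlt
      exact hns ⟨n, hs, not_lt.1 hlt⟩

/-- PID is applied to the ideal orthogonal to the principal down-sets. An infinite countable set
outside this ideal has an infinite part below a single element, which is what pseudoboundedness asks
for. -/
theorem finset_tukeyLE_or_isSigmaPseudobounded (hPID : PID.{u})
    (hb : Cardinal.aleph 1 < boundingNumber) {D : Type v} [Preorder D] [Nonempty D]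
    [IsDirectedOrder D] {ψ : Omega1 → D} (hψ : Function.Surjective ψ) :
    TukeyLE (Finset Omega1) D ∨ IsSigmaPseudobounded D := by
  let φ : ULift.{u} Omega1 → D := fun s => ψ s.down
  have hφ : Function.Surjective φ := fun d => (hψ d).elim fun α h => ⟨⟨α⟩, h⟩
  let T : Omega1 → Set (ULift.{u} Omega1) := fun α => {s | φ s ≤ ψ α}
  rcases hPID _ _ (isPIdeal_orthogonalIdeal (mk_omega1.symm ▸ hb) T) with
    ⟨X, hX, hXI⟩ | ⟨X, hXu, hXI⟩
  · left
    have : Cardinal.mk Omega1 ≤ Cardinal.mk (ULift.down '' X) := by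
      rw [mk_omega1, ← Cardinal.succ_aleph0, Order.succ_le_iff, ← not_le,
        Cardinal.le_aleph0_iff_set_countable]
      exact fun h => hX (countable_of_injective_of_countable_image
        ULift.down_injective.injOn h)
    obtain ⟨e⟩ := this
    have he : ∀ α, (⟨(e α : Omega1)⟩ : ULift.{u} Omega1) ∈ X := fun α => by
      obtain ⟨s, hs, hse⟩ := (e α).2
      rw [← hse]
      exact hs
    let x : Omega1 → ULift.{u} Omega1 := fun α => ⟨(e α : Omega1)⟩
    have hxinj : Function.Injective x := fun α β h =>
      e.injective (Subtype.ext (congrArg ULift.down h))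
    refine finset_tukeyLE (x := fun α => φ (x α)) fun d => ?_
    by_contra hinf
    obtain ⟨α, rfl⟩ := hψ d
    let a := Set.Infinite.natEmbedding _ hinf
    have hmem := hXI (range fun n => x (a n)) (by rintro _ ⟨n, rfl⟩; exact he _)
      (countable_range _)
    refine infinite_range_of_injective (f := fun n => x (a n))
      (hxinj.comp (Subtype.val_injective.comp a.injective)) ((hmem.2 α).subset ?_)
    rintro _ ⟨n, rfl⟩
    exact ⟨mem_range_self n, (a n).2⟩
  · right
    refine ⟨fun n => φ '' X n, by rw [← image_iUnion, hXu, image_univ, hφ.range_eq],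
      fun n A hA hinf hc => ?_⟩
    -- `φ` need not be injective; passing to a transversal `A'` makes infinite subsets of `A'` have
    -- infinite images.
    obtain ⟨A', hA'X, hA'⟩ := exists_subset_bijOn (X n ∩ φ ⁻¹' A) φ
    have himg : φ '' (X n ∩ φ ⁻¹' A) = A := by
      rw [image_inter_preimage]
      exact inter_eq_right.2 hA
    rw [himg] at hA'
    have hA'c : A'.Countable := hA'.mapsTo.countable_of_injOn hA'.injOn hc
    have hA'i : A'.Infinite := fun hf => hinf (hA'.image_eq ▸ hf.image φ)
    have hnot : A' ∉ orthogonalIdeal T := fun hmem => hA'i <| by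
      have := hXI n A' hmem
      rwa [inter_eq_left.2 (hA'X.trans inter_subset_left)] at this
    have : ∃ α, (A' ∩ T α).Infinite := by
      by_contra h
      push Not at h
      exact hnot ⟨hA'c, h⟩
    obtain ⟨α, hα⟩ := this
    refine ⟨φ '' (A' ∩ T α), ?_, hα.image (hA'.injOn.mono inter_subset_left), ψ α, ?_⟩
    · rw [← hA'.image_eq]
      exact image_mono inter_subset_left
    · rintro _ ⟨s, hs, rfl⟩
      exact hs.2

/-! ### Countable subsets of pseudobounded sets -/

/-- A form for sequences with repetitions: when the range is finite, directedness alone bounds every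
term. -/
theorem IsPseudobounded.exists_infinite_le {D : Type v} [Preorder D] [Nonempty D]
    [IsDirectedOrder D] {P : Set D} (hP : IsPseudobounded P) {d : ℕ → D} (hd : ∀ j, d j ∈ P) :
    ∃ e, {j | d j ≤ e}.Infinite := by
  by_cases hfin : (range d).Finite
  · obtain ⟨e, he⟩ := hfin.bddAbove
    refine ⟨e, infinite_univ.mono fun j _ => he (mem_range_self j)⟩
  · obtain ⟨E, hE, hEi, e, he⟩ := hP (range d) (range_subset_iff.2 hd) hfin (countable_range d)
    refine ⟨e, fun hf => hEi ((hf.image d).subset fun x hx => ?_)⟩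
    obtain ⟨j, rfl⟩ := hE hx
    exact mem_image_of_mem d (he hx)

section TraceIdeal

variable {D : Type v} [Preorder D] [Nonempty D] [IsDirectedOrder D]

/-- The ideal of those sets of indices on which the sequence `a` is bounded. -/
def traceIdeal (a : ℕ → D) : Order.Ideal (Set ℕ) :=
  idealOfUnion (fun B => BddAbove (a '' B)) (by simp)
    (fun _ _ hAB hB => hB.mono (image_mono hAB))
    (fun A B hA hB => by
      rw [image_union]
      exact hA.union hB)

theorem setOf_le_mem_traceIdeal (a : ℕ → D) (e : D) : {k | a k ≤ e} ∈ traceIdeal a := by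
  refine ⟨e, ?_⟩
  rintro _ ⟨k, hk, rfl⟩
  exact hk

theorem isTall_traceIdeal {P : Set D} (hP : IsPseudobounded P) {a : ℕ → D}
    (ha : ∀ k, a k ∈ P) : IsTall (traceIdeal a) := by
  intro A hA
  let b := Set.Infinite.natEmbedding A hA
  obtain ⟨e, he⟩ := hP.exists_infinite_le (d := fun j => a (b j)) fun j => ha _
  refine ⟨(fun j => (b j : ℕ)) '' {j | a (b j) ≤ e}, ⟨e, ?_⟩, ?_,
    he.image (Subtype.val_injective.comp b.injective).injOn⟩
  · rintro _ ⟨_, ⟨j, hj, rfl⟩, rfl⟩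
    exact hj
  · rintro _ ⟨j, hj, rfl⟩
    exact (b j).2

/-- Index sets are sorted by the piece `P n` containing a bound for them. If infinitely many of
these bounds lie below `e`, the corresponding index sets all lie in `{k | a k ≤ e}`. -/
theorem isSigmaPseudobounded_traceIdeal (hD : IsSigmaPseudobounded D) (a : ℕ → D) :
    IsSigmaPseudobounded (traceIdeal a) := by
  obtain ⟨P, hPu, hP⟩ := hD
  refine ⟨fun n => {B | ∃ d ∈ P n, ∀ k ∈ B.1, a k ≤ d}, ?_, fun n A hA hinf _ => ?_⟩
  · refine eq_univ_of_forall fun B => ?_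
    obtain ⟨d, hd⟩ := B.2
    obtain ⟨n, hn⟩ := mem_iUnion.1 (hPu ▸ mem_univ d)
    exact mem_iUnion.2 ⟨n, d, hn, fun k hk => hd (mem_image_of_mem a hk)⟩
  · let b := Set.Infinite.natEmbedding A hinf
    choose d hd hbd using fun j => hA (b j).2
    obtain ⟨e, he⟩ := (hP n).exists_infinite_le hd
    refine ⟨(fun j => (b j).1) '' {j | d j ≤ e}, ?_,
      he.image (Subtype.val_injective.comp b.injective).injOn,
      ⟨_, setOf_le_mem_traceIdeal a e⟩, ?_⟩
    · rintro _ ⟨j, -, rfl⟩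
      exact (b j).2
    · rintro _ ⟨j, hj, rfl⟩
      exact fun k hk => (hbd j k hk).trans hj

theorem exists_agree_of_mem_closure {Y : Set (ℕ → Bool)} {x : ℕ → Bool} (hx : x ∈ closure Y)
    (j : ℕ) : ∃ y ∈ Y, ∀ i ≤ j, y i = x i := by
  have hopen : IsOpen ((Iic j).pi fun i => ({x i} : Set Bool)) :=
    isOpen_set_pi (finite_Iic j) fun i _ => isOpen_discrete _
  obtain ⟨y, hy, hyY⟩ := mem_closure_iff.1 hx _ hopen fun i _ => rfl
  exact ⟨y, hyY, hy⟩

/-- The closure of the sets with a bound in `P n` stays inside the ideal. A limit `x` is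
approximated by sets with bounds `d j`, infinitely many of them below one `e`; each `k` in `x`
belongs to the `j`-th approximation for all `j ≥ k`, so `a k ≤ e`. -/
theorem isFSigma_traceIdeal (hD : IsSigmaPseudobounded D) (a : ℕ → D) :
    IsFSigma (traceIdeal a) := by
  obtain ⟨P, hPu, hP⟩ := hD
  refine ⟨fun n => closure {x | ∃ d ∈ P n, ∀ k, x k = true → a k ≤ d},
    fun n => isClosed_closure, ?_⟩
  refine Subset.antisymm (fun x ⟨d, hd⟩ => ?_) (iUnion_subset fun n x hx => ?_)
  · obtain ⟨n, hn⟩ := mem_iUnion.1 (hPu ▸ mem_univ d)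
    exact mem_iUnion.2 ⟨n, subset_closure ⟨d, hn, fun k hk => hd (mem_image_of_mem a hk)⟩⟩
  · choose y hy hyx using exists_agree_of_mem_closure hx
    choose d hd hyd using hy
    obtain ⟨e, he⟩ := (hP n).exists_infinite_le hd
    refine ⟨e, ?_⟩
    rintro _ ⟨k, hk, rfl⟩
    obtain ⟨j, hj, hkj⟩ := he.exists_gt k
    exact (hyd j k ((hyx j k hkj.le).trans hk)).trans hj

/-- Under `ℵ₁ < cof(𝓕_σ)`, countable subsets of pseudobounded subsets of a `σ`-pseudobounded
directed set of size `ℵ₁` are bounded. -/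
theorem IsPseudobounded.bddAbove_of_countable (hcof : Cardinal.aleph 1 < cofFSigma)
    {ψ : Omega1 → D} (hψ : Function.Surjective ψ) (hD : IsSigmaPseudobounded D) {P : Set D}
    (hP : IsPseudobounded P) {A : Set D} (hA : A ⊆ P) (hc : A.Countable) : BddAbove A := by
  rcases A.eq_empty_or_nonempty with rfl | hne
  · exact bddAbove_empty
  obtain ⟨a, rfl⟩ := hc.exists_eq_range hne
  by_contra hb
  let J := traceIdeal a
  -- Since `ψ` is onto, these at most `ℵ₁` sets are cofinal in `J`; `J` is proper exactly because
  -- the range of `a` is unbounded.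
  let t : Omega1 → J := fun α => ⟨{k | a k ≤ ψ α}, setOf_le_mem_traceIdeal a (ψ α)⟩
  have hle : cofFSigma ≤ Cardinal.mk (range t) := by
    refine csInf_le (OrderBot.bddBelow _) ⟨J, ⟨fun h => hb ?_, fun B hB => ?_⟩,
      isTall_traceIdeal hP (range_subset_iff.1 hA), isSigmaPseudobounded_traceIdeal hD a,
      isFSigma_traceIdeal hD a, range t, ?_, ?_, rfl⟩
    · rw [← image_univ]
      exact h
    · exact (hB.image a).bddAbove
    · rintro _ ⟨α, rfl⟩ _ ⟨β, rfl⟩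
      obtain ⟨d, h₁, h₂⟩ := exists_ge_ge (ψ α) (ψ β)
      obtain ⟨γ, rfl⟩ := hψ d
      exact ⟨t γ, mem_range_self γ, fun k (hk : a k ≤ ψ α) => hk.trans h₁,
        fun k (hk : a k ≤ ψ β) => hk.trans h₂⟩
    · rintro ⟨B, d, hd⟩
      obtain ⟨γ, rfl⟩ := hψ d
      exact ⟨t γ, mem_range_self γ, fun k hk => hd (mem_image_of_mem a hk)⟩
  exact absurd (hle.trans (Cardinal.mk_range_le.trans mk_omega1.le)) (not_le.2 hcof)

end TraceIdeal

theorem onlyFiveCofinalTypes_of_lt (hPID : PID.{u})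
    (h : Cardinal.aleph 1 < min boundingNumber cofFSigma) : OnlyFiveCofinalTypes.{v} := by
  intro D _ _ _ hcard
  obtain ⟨hb, hcof⟩ := lt_min_iff.1 h
  obtain ⟨ψ, hψ⟩ := exists_surjective_omega1 hcard
  rcases finset_tukeyLE_or_isSigmaPseudobounded hPID hb hψ with hle | hD
  · exact Or.inr (Or.inr (Or.inr (Or.inr ⟨tukeyLE_finset hψ, hle⟩)))
  · obtain ⟨P, hPu, hP⟩ := id hD
    rcases four_types_of_tukeyLE hψ (tukeyLE_prod_of_cover hψ hPu fun n A hA hc =>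
      (hP n).bddAbove_of_countable hcof hψ hD hA hc) with h | h | h | h
    · exact Or.inl h
    · exact Or.inr (Or.inl h)
    · exact Or.inr (Or.inr (Or.inl h))
    · exact Or.inr (Or.inr (Or.inr (Or.inl h)))

/-! ### A tall `σ`-pseudobounded `F_σ` ideal -/

section Growth

open Classical in
/-- The number of elements of `A` below `2 ^ m`. -/
noncomputable def dyadicCount (A : Set ℕ) (m : ℕ) : ℕ := ((Finset.range (2 ^ m)).filter (· ∈ A)).card

theorem dyadicCount_mono {A B : Set ℕ} {m : ℕ} (h : ∀ k < 2 ^ m, k ∈ A → k ∈ B) :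
    dyadicCount A m ≤ dyadicCount B m := by
  classical
  refine Finset.card_le_card fun k hk => ?_
  rw [Finset.mem_filter, Finset.mem_range] at hk ⊢
  exact ⟨hk.1, h k hk.1 hk.2⟩

theorem dyadicCount_le_card {A : Set ℕ} {m : ℕ} {F : Finset ℕ}
    (h : ∀ k < 2 ^ m, k ∈ A → k ∈ F) : dyadicCount A m ≤ F.card := by
  classical
  refine Finset.card_le_card fun k hk => ?_
  rw [Finset.mem_filter, Finset.mem_range] at hk
  exact h k hk.1 hk.2

theorem dyadicCount_biUnion_le (A : ℕ → Set ℕ) (m n : ℕ) {c : ℕ}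
    (h : ∀ j ≤ n, dyadicCount (A j) m ≤ c) :
    dyadicCount (⋃ j ∈ Iic n, A j) m ≤ (n + 1) * c := by
  classical
  have : (Finset.range (2 ^ m)).filter (· ∈ ⋃ j ∈ Iic n, A j) ⊆
      (Finset.range (n + 1)).biUnion fun j => (Finset.range (2 ^ m)).filter (· ∈ A j) := by
    intro k hk
    rw [Finset.mem_filter, mem_iUnion₂] at hk
    obtain ⟨hk, j, hj, hkj⟩ := hk
    exact Finset.mem_biUnion.2 ⟨j, Finset.mem_range.2 (Nat.lt_succ_of_le hj),
      Finset.mem_filter.2 ⟨hk, hkj⟩⟩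
  refine (Finset.card_le_card this).trans
    ((Finset.card_biUnion_le_card_mul _ _ c fun j hj => ?_).trans ?_)
  · exact h j (Nat.lt_succ_iff.1 (Finset.mem_range.1 hj))
  · rw [Finset.card_range]

/-- The sets whose number of elements below `2 ^ m` is at most `(m + 2) ^ N`, for every `m`. -/
def HasGrowth (N : ℕ) (A : Set ℕ) : Prop := ∀ m, dyadicCount A m ≤ (m + 2) ^ N

theorem HasGrowth.mono {N : ℕ} {A B : Set ℕ} (h : HasGrowth N B) (hAB : A ⊆ B) : HasGrowth N A :=
  fun m => (dyadicCount_mono fun _ _ hk => hAB hk).trans (h m)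

theorem HasGrowth.mono_exponent {N M : ℕ} {A : Set ℕ} (h : HasGrowth N A) (hNM : N ≤ M) :
    HasGrowth M A :=
  fun m => (h m).trans (Nat.pow_le_pow_right (by omega) hNM)

theorem HasGrowth.union {N : ℕ} {A B : Set ℕ} (hA : HasGrowth N A) (hB : HasGrowth N B) :
    HasGrowth (N + 1) (A ∪ B) := fun m => by
  have hsub : A ∪ B ⊆ ⋃ j ∈ Iic 1, (fun j : ℕ => if j = 0 then A else B) j := by
    rintro k (hk | hk)
    · exact mem_iUnion₂.2 ⟨0, by simp, by simpa using hk⟩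
    · exact mem_iUnion₂.2 ⟨1, by simp, by simpa using hk⟩
  have hle := dyadicCount_biUnion_le (fun j : ℕ => if j = 0 then A else B) m 1
    (c := (m + 2) ^ N) fun j _ => by
      split_ifs
      · exact hA m
      · exact hB m
  calc dyadicCount (A ∪ B) m ≤ (1 + 1) * (m + 2) ^ N :=
        (dyadicCount_mono fun _ _ hk => hsub hk).trans hle
    _ ≤ (m + 2) * (m + 2) ^ N := Nat.mul_le_mul_right _ (by omega)
    _ = (m + 2) ^ (N + 1) := (pow_succ' _ _).symm

theorem hasGrowth_of_finite {A : Set ℕ} (hA : A.Finite) : ∃ N, HasGrowth N A := by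
  refine ⟨hA.toFinset.card, fun m => ?_⟩
  calc dyadicCount A m ≤ hA.toFinset.card := dyadicCount_le_card fun k _ hk => by simpa using hk
    _ ≤ 2 ^ hA.toFinset.card := Nat.lt_two_pow_self.le
    _ ≤ (m + 2) ^ hA.toFinset.card := Nat.pow_le_pow_left (by omega) _

theorem not_hasGrowth_univ (N : ℕ) : ¬ HasGrowth N univ := by
  intro h
  have h₁ : ∀ m : ℕ, 2 ^ m ≤ (m + 2) ^ N := fun m => by
    simpa [dyadicCount] using h m
  have ht := (tendsto_pow_const_div_const_pow_of_one_lt N (r := (2 : ℝ)) one_lt_two).comp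
    (tendsto_add_atTop_nat 2)
  -- The bound `1 / 4` cancels the factor `2 ^ 2` produced by the shift from `m` to `m + 2`.
  obtain ⟨m, hm⟩ := (ht.eventually (gt_mem_nhds (show (0 : ℝ) < 1 / 4 by norm_num))).exists
  simp only [Function.comp_apply] at hm
  rw [div_lt_iff₀ (by positivity), pow_add] at hm
  have h₂ : ((2 : ℝ) ^ m) ≤ ((m + 2 : ℕ) : ℝ) ^ N := by exact_mod_cast h₁ m
  linarith

/-- The ideal of sets of polylogarithmic growth. -/
def growthIdeal : Order.Ideal (Set ℕ) :=
  idealOfUnion (fun A => ∃ N, HasGrowth N A) (hasGrowth_of_finite finite_empty)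
    (fun _ _ hAB ⟨N, hN⟩ => ⟨N, hN.mono hAB⟩)
    (fun _ _ ⟨N, hN⟩ ⟨M, hM⟩ => ⟨max N M + 1, (hN.mono_exponent (le_max_left N M)).union
      (hM.mono_exponent (le_max_right N M))⟩)

theorem isIdealOnOmega_growthIdeal : IsIdealOnOmega growthIdeal where
  univ_notMem := fun ⟨N, hN⟩ => not_hasGrowth_univ N hN
  mem_of_finite _ hA := hasGrowth_of_finite hA

/-- An infinite set contains a sequence with `b j > 2 ^ j`, which has at most `m` terms below `2 ^
m`. -/
theorem isTall_growthIdeal : IsTall growthIdeal := by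
  intro A hA
  choose b hbA hb using fun j : ℕ => hA.exists_gt (2 ^ j)
  refine ⟨range b, ⟨1, fun m => ?_⟩, range_subset_iff.2 hbA, fun hf => ?_⟩
  · calc dyadicCount (range b) m ≤ ((Finset.range m).image b).card := by
          refine dyadicCount_le_card ?_
          rintro _ hk ⟨j, rfl⟩
          refine Finset.mem_image_of_mem b (Finset.mem_range.2 ?_)
          exact (Nat.pow_lt_pow_iff_right one_lt_two).1 ((hb j).trans hk)
      _ ≤ m := Finset.card_image_le.trans (Finset.card_range m).le
      _ ≤ (m + 2) ^ 1 := by rw [pow_one]; omega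
  · obtain ⟨M, hM⟩ := hf.bddAbove
    exact absurd (hM (mem_range_self M)) (not_le.2 (Nat.lt_two_pow_self.trans (hb M)))

theorem continuous_dyadicCount (m : ℕ) :
    Continuous fun x : ℕ → Bool => dyadicCount {k | x k = true} m := by
  have : (fun x : ℕ → Bool => dyadicCount {k | x k = true} m) =
      fun x => ∑ k ∈ Finset.range (2 ^ m), (x k).toNat := by
    funext x
    rw [dyadicCount, Finset.card_filter]
    refine Finset.sum_congr rfl fun k _ => ?_
    cases h : x k <;> simp [h]
  rw [this]
  exact continuous_finsetSum _ fun k _ =>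
    (continuous_of_discreteTopology (f := Bool.toNat)).comp (continuous_apply k)

theorem isFSigma_growthIdeal : IsFSigma growthIdeal := by
  refine ⟨fun N => {x | HasGrowth N {k | x k = true}}, fun N => ?_, ?_⟩
  · have : {x : ℕ → Bool | HasGrowth N {k | x k = true}} =
        ⋂ m, {x | dyadicCount {k | x k = true} m ≤ (m + 2) ^ N} := by
      ext x
      simp [HasGrowth]
    change IsClosed {x : ℕ → Bool | HasGrowth N {k | x k = true}}
    rw [this]
    exact isClosed_iInter fun m => isClosed_le (continuous_dyadicCount m) continuous_const
  · ext x
    simp [growthIdeal, mem_idealOfUnion]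

/-- An infinite set of subsets of `ω` contains an infinite sequence converging to some set. -/
theorem exists_injective_seq_agree {A : Set (Set ℕ)} (hA : A.Infinite) :
    ∃ (C : Set ℕ) (b : ℕ → Set ℕ), (∀ j, b j ∈ A) ∧ (range b).Infinite ∧
      ∀ j, ∀ k < 2 ^ j, (k ∈ b j ↔ k ∈ C) := by
  classical
  let e : Set ℕ → ℕ → Bool := fun B k => decide (k ∈ B)
  have he : Function.Injective e := fun B B' h => by
    ext k
    simpa [e] using congrFun h k
  obtain ⟨x, -, hx⟩ := (hA.image he.injOn).exists_accPt_of_subset_isCompact isCompact_univ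
    (subset_univ _)
  rw [accPt_iff_frequently] at hx
  have hex : ∀ j : ℕ, ∃ B ∈ A, e B ≠ x ∧ ∀ k < 2 ^ j, e B k = x k := fun j => by
    have hopen : IsOpen ((Iio (2 ^ j)).pi fun i => ({x i} : Set Bool)) :=
      isOpen_set_pi (finite_Iio _) fun i _ => isOpen_discrete _
    obtain ⟨_, ⟨hne, B, hB, rfl⟩, hy⟩ :=
      (hx.and_eventually (hopen.mem_nhds fun i _ => rfl)).exists
    exact ⟨B, hB, hne, hy⟩
  choose b hbA hbne hb using hex
  refine ⟨{k | x k = true}, b, hbA, fun hfin => ?_, fun j k hk => ?_⟩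
  -- No `b j` equals the limit. If there were finitely many, all would differ from it at places at
  -- most `M < 2 ^ M`, where `b M` agrees with it.
  · have hd : ∀ B ∈ range b, ∃ k, e B k ≠ x k := by
      rintro _ ⟨j, rfl⟩
      exact Function.ne_iff.1 (hbne j)
    choose! d hd using hd
    obtain ⟨M, hM⟩ := (hfin.image d).bddAbove
    refine hd (b M) (mem_range_self M) (hb M _ ?_)
    exact (hM (mem_image_of_mem d (mem_range_self M))).trans_lt Nat.lt_two_pow_self
  · change k ∈ b j ↔ x k = true
    rw [← hb j k hk]
    simp [e]

/-- Along a convergent sequence, all `B j` with `j ≥ m` coincide with `B m` below `2 ^ m`. There the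
whole union is a union of `m + 1` sets, a factor absorbed by raising the exponent by one. -/
theorem isSigmaPseudobounded_growthIdeal : IsSigmaPseudobounded growthIdeal := by
  refine ⟨fun N => {B | HasGrowth N B.1}, ?_, fun N A hA hinf _ => ?_⟩
  · exact eq_univ_of_forall fun B => mem_iUnion.2 B.2
  · obtain ⟨C, b, hbA, hbi, hb⟩ := exists_injective_seq_agree
      (hinf.image Subtype.val_injective.injOn)
    choose B hBA hB using hbA
    obtain rfl : (fun j => (B j).1) = b := funext hB
    refine ⟨range B, range_subset_iff.2 hBA, fun hf => hbi ?_,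
      ⟨⋃ j, (B j).1, N + 1, fun m => ?_⟩, ?_⟩
    · rw [range_comp' Subtype.val B]
      exact hf.image _
    · have hsub : ∀ k < 2 ^ m, k ∈ (⋃ j, (B j).1) → k ∈ ⋃ j ∈ Iic m, (B j).1 := by
        intro k hk hkB
        obtain ⟨j, hj⟩ := mem_iUnion.1 hkB
        rcases le_total j m with hjm | hjm
        · exact mem_iUnion₂.2 ⟨j, hjm, hj⟩
        · have hk' : k < 2 ^ j := hk.trans_le (Nat.pow_le_pow_right two_pos hjm)
          exact mem_iUnion₂.2 ⟨m, mem_Iic.2 le_rfl, (hb m k hk).2 ((hb j k hk').1 hj)⟩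
      calc dyadicCount (⋃ j, (B j).1) m ≤ (m + 1) * (m + 2) ^ N :=
            (dyadicCount_mono hsub).trans
              (dyadicCount_biUnion_le _ m m fun j _ => hA (hBA j) m)
        _ ≤ (m + 2) * (m + 2) ^ N := Nat.mul_le_mul_right _ (by omega)
        _ = (m + 2) ^ (N + 1) := (pow_succ' _ _).symm
    · rintro _ ⟨j, rfl⟩
      exact subset_iUnion (fun j => (B j).1) j

/-- The growth ideal shows that the infimum is over a nonempty set, hence attained rather than the
default value `0`. -/
theorem exists_mk_eq_cofFSigma : ∃ I : Order.Ideal (Set ℕ),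
    IsIdealOnOmega I ∧ IsTall I ∧ IsSigmaPseudobounded I ∧ IsFSigma I ∧
      ∃ X : Set I, DirectedOn (· ≤ ·) X ∧ IsCofinal X ∧ Cardinal.mk X = cofFSigma :=
  csInf_mem (s := {κ | ∃ I : Order.Ideal (Set ℕ),
    IsIdealOnOmega I ∧ IsTall I ∧ IsSigmaPseudobounded I ∧ IsFSigma I ∧
      ∃ X : Set I, DirectedOn (· ≤ ·) X ∧ IsCofinal X ∧ Cardinal.mk X = κ})
    ⟨_, growthIdeal, isIdealOnOmega_growthIdeal, isTall_growthIdeal,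
      isSigmaPseudobounded_growthIdeal, isFSigma_growthIdeal, univ,
      fun A _ B _ => (growthIdeal.directed A.1 A.2 B.1 B.2).elim fun C h => ⟨⟨C, h.1⟩, mem_univ _, h.2⟩,
      fun A => ⟨A, mem_univ A, le_rfl⟩, rfl⟩

end Growth

/-! ### The five types and `cof(𝓕_σ)` -/

/-- If there are only five cofinal types, then a directed set of size at most `ℵ₁` in which each
uncountable set has an infinite bounded subset is covered by countably many sets whose countable
subsets are bounded. -/
theorem OnlyFiveCofinalTypes.exists_cover (h : OnlyFiveCofinalTypes.{v}) {D : Type}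
    [PartialOrder D] [Nonempty D] [IsDirectedOrder D] (hD : Cardinal.mk D ≤ Cardinal.aleph 1)
    (hinf : ∀ Y : Set D, ¬ Y.Countable → ∃ A ⊆ Y, A.Infinite ∧ BddAbove A) :
    ∃ P : ℕ → Set D, (⋃ n, P n) = univ ∧ ∀ n, ∀ A ⊆ P n, A.Countable → BddAbove A := by
  have hdir : IsDirectedOrder (ULift.{v} D) :=
    ⟨fun a b => (exists_ge_ge a.down b.down).elim fun c hc => ⟨⟨c⟩, hc⟩⟩
  have hcard : Cardinal.mk (ULift.{v} D) ≤ Cardinal.aleph 1 := by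
    rw [Cardinal.mk_uLift]
    calc _ ≤ Cardinal.lift.{v} (Cardinal.aleph.{0} 1) := Cardinal.lift_le.2 hD
      _ = _ := by simp
  have hup : TukeyLE D (ULift.{v} D) := TukeyLE.of_bddAbove ULift.up fun X ⟨b, hb⟩ =>
    ⟨b.down, fun x hx => hb (mem_image_of_mem _ hx)⟩
  have hdown : TukeyLE (ULift.{v} D) D := TukeyLE.of_bddAbove ULift.down fun X ⟨b, hb⟩ =>
    ⟨⟨b⟩, fun x hx => hb (mem_image_of_mem _ hx)⟩
  rcases h (ULift.{v} D) hcard with h | h | h | h | h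
  · exact exists_cover_of_tukeyLE_prod ((hup.trans h.1).trans TukeyLE.from_unit)
  · exact exists_cover_of_tukeyLE_prod ((hup.trans h.1).trans TukeyLE.prod_left)
  · exact exists_cover_of_tukeyLE_prod ((hup.trans h.1).trans TukeyLE.prod_right)
  · exact exists_cover_of_tukeyLE_prod (hup.trans h.1)
  · obtain ⟨Y, hY, hYA⟩ := exists_uncountable_of_finset_tukeyLE (h.2.trans hdown)
    obtain ⟨A, hA, hAi, hAb⟩ := hinf Y hY
    exact absurd hAb (hYA A hA hAi)

/-- Choose `x n ≥ n` outside the first `n + 1` sets; each `B n` then contains `x j` only for `j <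
n`, so no infinite subset of the range is in the ideal. -/
theorem not_isTall_of_countable_cover {I : Order.Ideal (Set ℕ)} (hI : IsIdealOnOmega I)
    {B : ℕ → Set ℕ} (hB : ∀ n, B n ∈ I) (hcov : ∀ A ∈ I, ∃ n, A ⊆ B n) : ¬ IsTall I := by
  intro htall
  have hunion : ∀ n, (⋃ i ∈ Iic n, B i) ∈ I := fun n => by
    induction n with
    | zero => simpa using hB 0
    | succ n ih =>
      have : (⋃ i ∈ Iic (n + 1), B i) = (⋃ i ∈ Iic n, B i) ∪ B (n + 1) := by
        rw [← Order.succ_eq_add_one, Order.Iic_succ, biUnion_insert, union_comm]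
      rw [this]
      exact Order.Ideal.sup_mem ih (hB _)
  have hex : ∀ n, ∃ k, n ≤ k ∧ k ∉ ⋃ i ∈ Iic n, B i := fun n => by
    by_contra h
    push Not at h
    refine hI.univ_notMem (I.lower ?_
      (Order.Ideal.sup_mem (hI.mem_of_finite _ (finite_Iio n)) (hunion n)))
    intro k _
    rcases lt_or_ge k n with hk | hk
    · exact Or.inl hk
    · exact Or.inr (h k hk)
  choose x hxn hx using hex
  have hxi : (range x).Infinite := fun hf => by
    obtain ⟨M, hM⟩ := hf.bddAbove
    exact absurd (hM (mem_range_self (M + 1))) (not_le.2 (Nat.lt_of_succ_le (hxn _)))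
  obtain ⟨A, hA, hAx, hAi⟩ := htall _ hxi
  obtain ⟨n, hn⟩ := hcov A hA
  refine hAi (((finite_Iio n).image x).subset fun a ha => ?_)
  obtain ⟨j, rfl⟩ := hAx ha
  refine mem_image_of_mem x (mem_Iio.2 <| not_le.1 fun hnj => hx j (mem_iUnion₂.2 ⟨n, hnj, hn ha⟩))

/-- An uncountable subset of the cofinal set `X` meets some pseudobounded piece in an infinite set,
so `exists_cover` applies. The union of each piece `P n` is already the union of countably many of
its members, because it is a subset of `ω`; so it lies inside a member of the ideal, and countably
many members cover the ideal, contradicting tallness. -/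
theorem OnlyFiveCofinalTypes.lt_cofFSigma (h : OnlyFiveCofinalTypes.{v}) :
    Cardinal.aleph 1 < cofFSigma := by
  by_contra hle
  obtain ⟨I, hI, htall, ⟨Q, hQu, hQ⟩, -, X, hXd, hXc, hXcard⟩ := exists_mk_eq_cofFSigma
  have : IsDirectedOrder X := directedOn_iff_isDirectedOrder.1 hXd
  obtain ⟨x₀, hx₀, -⟩ := hXc (Classical.choice ⟨⟨∅, hI.mem_of_finite _ finite_empty⟩⟩)
  have : Nonempty X := ⟨⟨x₀, hx₀⟩⟩
  obtain ⟨P, hPu, hP⟩ := h.exists_cover (D := X) (hXcard.trans_le (not_lt.1 hle)) fun Y hY => by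
    have hcov : Y ⊆ ⋃ n, (Y ∩ Subtype.val ⁻¹' Q n) := fun y hy => by
      obtain ⟨n, hn⟩ := mem_iUnion.1 (hQu ▸ mem_univ y.1)
      exact mem_iUnion.2 ⟨n, hy, hn⟩
    obtain ⟨n, hn⟩ : ∃ n, ¬ (Y ∩ Subtype.val ⁻¹' Q n).Countable := by
      by_contra hc
      push Not at hc
      exact hY ((countable_iUnion hc).mono hcov)
    have hni : (Y ∩ Subtype.val ⁻¹' Q n).Infinite := fun hf => hn hf.countable
    let a := Set.Infinite.natEmbedding _ hni
    have hainj : Function.Injective fun j => (a j).1.1 :=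
      Subtype.val_injective.comp (Subtype.val_injective.comp a.injective)
    have : IsDirectedOrder I := directedOn_iff_isDirectedOrder.1 I.directed
    have : Nonempty I := ⟨x₀⟩
    obtain ⟨e, he⟩ := (hQ n).exists_infinite_le (d := fun j => (a j).1.1) fun j => (a j).2.2
    obtain ⟨y, hy, hey⟩ := hXc e
    refine ⟨(fun j => (a j).1) '' {j | (a j).1.1 ≤ e}, ?_,
      he.image (Subtype.val_injective.comp a.injective).injOn, ⟨y, hy⟩, ?_⟩
    · rintro _ ⟨j, -, rfl⟩
      exact (a j).2.1
    · rintro _ ⟨j, hj, rfl⟩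
      exact (show (a j).1.1 ≤ e from hj).trans hey
  have hB : ∀ n, ∃ B ∈ I, ∀ A ∈ P n, A.1.1 ⊆ B := fun n => by
    have hw : ∀ k : ↥(⋃ A ∈ P n, A.1.1), ∃ A ∈ P n, k.1 ∈ A.1.1 := fun k => by
      simpa using k.2
    choose w hwP hw using hw
    obtain ⟨B, hB⟩ := hP n (range w) (range_subset_iff.2 hwP) (countable_range w)
    refine ⟨B.1.1, B.1.2, fun A hA k hk => ?_⟩
    have hk' : k ∈ ⋃ A ∈ P n, A.1.1 := mem_biUnion hA hk
    exact hB (mem_range_self ⟨k, hk'⟩) (hw ⟨k, hk'⟩)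
  choose B hBI hB using hB
  refine not_isTall_of_countable_cover hI hBI (fun A hA => ?_) htall
  obtain ⟨y, hy, hAy⟩ := hXc ⟨A, hA⟩
  obtain ⟨n, hn⟩ := mem_iUnion.1 (hPu ▸ mem_univ (⟨y, hy⟩ : X))
  exact ⟨n, Subset.trans hAy (hB n _ hn)⟩

/-! ### The five types and `𝔟` -/

theorem exists_monotone_eventually_ge {S : Set (ℕ → ℕ)} (hS : S.Countable) :
    ∃ g : ℕ → ℕ, Monotone g ∧ ∀ f ∈ S, f ≤ᶠ[atTop] g := by
  obtain ⟨u, hu⟩ : ∃ u : ℕ → ℕ → ℕ, S ⊆ range u := countable_iff_exists_subset_range.1 hS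
  refine ⟨fun n => ∑ j ∈ Finset.range (n + 1), ∑ i ∈ Finset.range (n + 1), u j i,
    fun n m hnm => ?_, fun f hf => ?_⟩
  · have hsub : Finset.range (n + 1) ⊆ Finset.range (m + 1) := Finset.range_mono (by omega)
    exact (Finset.sum_le_sum fun j _ => Finset.sum_le_sum_of_subset hsub).trans
      (Finset.sum_le_sum_of_subset hsub)
  · obtain ⟨j, rfl⟩ := hu hf
    refine eventually_atTop.2 ⟨j, fun n hn => ?_⟩
    exact (Finset.single_le_sum (f := u j) (fun _ _ => Nat.zero_le _)
      (Finset.self_mem_range_succ n)).trans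
      (Finset.single_le_sum (f := fun j => ∑ i ∈ Finset.range (n + 1), u j i)
        (fun _ _ => Nat.zero_le _) (Finset.mem_range.2 (Nat.lt_succ_of_le hn)))

/-- For a given bound `c` on the initial values, the functions obeying `H` from some point on run
through a finitely branching tree, so their values at each level are bounded. One function
eventually dominates the resulting bounds for all `c`. -/
theorem exists_finite_branching_bound (H : ∀ l : ℕ, (Fin l → ℕ) → ℕ) :
    ∃ h : ℕ → ℕ, ∀ g : ℕ → ℕ, (∀ᶠ l in atTop, g l ≤ H l fun i => g i) → g ≤ᶠ[atTop] h := by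
  have hc : ∀ c : ℕ, ∃ h : ℕ → ℕ, ∀ l, c ≤ h l ∧
      ∀ t : Fin l → ℕ, (∀ i, t i ≤ h i) → H l t ≤ h l := fun c => by
    let F : ∀ l : ℕ, (∀ i < l, ℕ) → ℕ := fun l p =>
      max c ((Fintype.piFinset fun i : Fin l => Finset.Iic (p i i.2)).sup (H l))
    let h : ℕ → ℕ := wellFounded_lt.fix F
    have hh : ∀ l, h l = F l fun i _ => h i := fun l => wellFounded_lt.fix_eq F l
    refine ⟨h, fun l => ⟨?_, fun t ht => ?_⟩⟩
    · rw [hh]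
      exact le_max_left _ _
    · rw [hh]
      refine le_max_of_le_right (Finset.le_sup (f := H l) ?_)
      exact Fintype.mem_piFinset.2 fun i => Finset.mem_Iic.2 (ht i)
  choose h hh using hc
  obtain ⟨k, -, hk⟩ := exists_monotone_eventually_ge (countable_range h)
  refine ⟨k, fun g hg => ?_⟩
  obtain ⟨l₀, hl₀⟩ := eventually_atTop.1 hg
  obtain ⟨c, hc⟩ := ((finite_Iio l₀).image g).bddAbove
  have : ∀ l, g l ≤ h c l := fun l => by
    induction l using Nat.strong_induction_on with
    | _ l ih =>
      rcases lt_or_ge l l₀ with hl | hl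
      · exact (hc (mem_image_of_mem g hl)).trans (hh c l).1
      · exact (hl₀ l hl).trans ((hh c l).2 _ fun i => ih i i.2)
  exact EventuallyLE.trans (Eventually.of_forall this) (hk _ (mem_range_self c))

theorem exists_countable_dense (X : Set (ℕ → ℕ)) :
    ∃ D ⊆ X, D.Countable ∧ ∀ g ∈ X, ∀ l, ∃ f ∈ D, ∀ i < l, f i = g i := by
  let J := {p : Σ l : ℕ, Fin l → ℕ // ∃ g ∈ X, ∀ i : Fin p.1, g i = p.2 i}
  choose w hwX hw using fun p : J => p.2
  refine ⟨range w, range_subset_iff.2 hwX, countable_range w, fun g hg l => ?_⟩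
  let p : J := ⟨⟨l, fun i => g i⟩, g, hg, fun i => rfl⟩
  exact ⟨w p, mem_range_self p, fun i hi => hw p ⟨i, hi⟩⟩

/-- If `E` is dense in a family of monotone functions and `γ` eventually dominates all members of
`E`, then each unbounded subfamily of functions above `γ` has a member which is everywhere above
infinitely many members of `E`. -/
theorem exists_infinite_le_of_unbounded {X E : Set (ℕ → ℕ)} (hX : ∀ g ∈ X, Monotone g)
    (hEX : E ⊆ X) (hE : ∀ g ∈ X, ∀ l, ∃ f ∈ E, ∀ i < l, f i = g i) {γ : ℕ → ℕ}
    (hγ : ∀ f ∈ E, f ≤ᶠ[atTop] γ) {Y : Set (ℕ → ℕ)} (hYX : Y ⊆ X \ E)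
    (hYγ : ∀ g ∈ Y, γ ≤ᶠ[atTop] g) (hY : ¬ ∃ h, ∀ g ∈ Y, g ≤ᶠ[atTop] h) :
    ∃ g ∈ Y, {f ∈ E | f ≤ g}.Infinite := by
  choose! m hm using fun f hf => eventually_atTop.1 (hγ f hf)
  have hr : ∀ l (t : Fin l → ℕ), ∃ f : ℕ → ℕ,
      (∃ g ∈ X, ∀ i : Fin l, g i = t i) → f ∈ E ∧ ∀ i : Fin l, f i = t i := fun l t => by
    by_cases h : ∃ g ∈ X, ∀ i : Fin l, g i = t i
    · obtain ⟨g, hg, hgt⟩ := h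
      obtain ⟨f, hf, hfg⟩ := hE g hg l
      exact ⟨f, fun _ => ⟨hf, fun i => (hfg i i.2).trans (hgt i)⟩⟩
    · exact ⟨0, fun h' => absurd h' h⟩
  choose r hr using hr
  -- Here `r l t` is a member of `E` extending `t`, and it is below `γ` from `m (r l t)` on. As `Y`
  -- is unbounded, some `g ∈ Y` exceeds at infinitely many `l` the value of `r l (g ↾ l)` at that
  -- point.
  obtain ⟨h, hh⟩ := exists_finite_branching_bound fun l t => r l t (m (r l t))
  have : ∃ g ∈ Y, ¬ ∀ᶠ l in atTop, g l ≤ r l (fun i => g i) (m (r l fun i => g i)) := by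
    by_contra hcon
    push Not at hcon
    exact hY ⟨h, fun g hg => hh g (hcon g hg)⟩
  obtain ⟨g, hg, hgr⟩ := this
  have hgX := hYX hg
  refine ⟨g, hg, fun hfin => ?_⟩
  have hd : ∀ f ∈ {f ∈ E | f ≤ g}, ∃ k, f k ≠ g k := fun f hf =>
    Function.ne_iff.1 fun h => hgX.2 (h ▸ hf.1)
  choose! d hd using hd
  obtain ⟨M, hM⟩ := (hfin.image d).bddAbove
  obtain ⟨n, hn⟩ := eventually_atTop.1 (hYγ g hg)
  rw [not_eventually] at hgr
  obtain ⟨l, hl, hlr⟩ := frequently_atTop.1 hgr (max n (M + 1))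
  rw [not_le] at hlr
  set f := r l fun i => g i
  obtain ⟨hfE, hfg⟩ := hr l (fun i => g i) ⟨g, hgX.1, fun i => rfl⟩
  -- Three ranges: below `l` the functions agree; from `l` to `m f` monotonicity gives `f i ≤ f (m
  -- f) < g l ≤ g i`; from `m f` on, `f ≤ γ ≤ g`.
  have hfle : f ≤ g := fun i => by
    rcases lt_or_ge i l with hi | hi
    · exact (hfg ⟨i, hi⟩).le
    · rcases le_total i (m f) with him | him
      · exact ((hX f (hEX hfE) him).trans hlr.le).trans (hX g hgX.1 hi)
      · exact (hm f hfE i him).trans (hn i ((le_max_left _ _).trans (hl.trans hi)))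
  have hdf := hM (mem_image_of_mem d (show f ∈ {f ∈ E | f ≤ g} from ⟨hfE, hfle⟩))
  have hdl : d f < l := (Nat.lt_succ_of_le hdf).trans_le ((le_max_right _ _).trans hl)
  exact hd f ⟨hfE, hfle⟩ (hfg ⟨d f, hdl⟩)

theorem exists_monotone_scale (h : Omega1 → ℕ → ℕ) :
    ∃ f : Omega1 → ℕ → ℕ, (∀ α, Monotone (f α)) ∧ (∀ α β, α < β → f α ≤ᶠ[atTop] f β) ∧
      ∀ α, h α ≤ᶠ[atTop] f α := by
  choose! G hGm hG using fun (S : Set (ℕ → ℕ)) (hS : S.Countable) =>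
    exists_monotone_eventually_ge hS
  let S : ∀ β : Omega1, (∀ α < β, ℕ → ℕ) → Set (ℕ → ℕ) := fun β p =>
    insert (h β) (range fun α : Iio β => p α α.2)
  have hS : ∀ β p, (S β p).Countable := fun β p => by
    have : Countable (Iio β) := (countable_Iio_omega1 β).to_subtype
    exact (countable_range _).insert _
  let f : Omega1 → ℕ → ℕ := wellFounded_lt.fix fun β p => G (S β p)
  have hf : ∀ β, f β = G (S β fun α _ => f α) := fun β => wellFounded_lt.fix_eq _ β
  have hc : ∀ β, (S β fun α _ => f α).Countable := fun β =>
    hS β fun α _ => f α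
  refine ⟨f, fun β => ?_, fun α β hαβ => ?_, fun β => ?_⟩
  · rw [hf]
    exact hGm _ (hc β)
  · rw [hf β]
    exact hG _ (hc β) _ (Or.inr ⟨⟨α, hαβ⟩, rfl⟩)
  · rw [hf β]
    exact hG _ (hc β) _ (Or.inl rfl)

theorem exists_mk_eq_boundingNumber : ∃ F : Set (ℕ → ℕ),
    (¬ ∃ g : ℕ → ℕ, ∀ f ∈ F, EventuallyLess f g) ∧ Cardinal.mk F = boundingNumber := by
  refine csInf_mem (s := {κ | ∃ F : Set (ℕ → ℕ),
    (¬ ∃ g : ℕ → ℕ, ∀ f ∈ F, EventuallyLess f g) ∧ Cardinal.mk F = κ}) ⟨_, univ, ?_, rfl⟩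
  rintro ⟨g, hg⟩
  have := hg g (mem_univ g)
  simp only [EventuallyLess, lt_irrefl, not_false_eq_true] at this
  exact infinite_univ this

theorem eventuallyLess_succ {f g : ℕ → ℕ} (h : f ≤ᶠ[atTop] g) :
    EventuallyLess f fun n => g n + 1 := by
  obtain ⟨n, hn⟩ := eventually_atTop.1 h
  exact (finite_Iio n).subset fun k hk => not_le.1 fun hnk => hk (Nat.lt_succ_of_le (hn k hnk))

/-- The directed set consists of the functions `max (f α) N` for an unbounded scale `f`, ordered
everywhere; the constants `N` turn eventual domination into domination everywhere.
`exists_infinite_le_of_unbounded` finds an infinite bounded subset in each uncountable set. A cover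
would have an uncountable piece with a bounded countable dense subset, and the bound would pass to
the whole piece, although uncountable subsets are unbounded even modulo finite. -/
theorem OnlyFiveCofinalTypes.lt_boundingNumber (h : OnlyFiveCofinalTypes.{v}) :
    Cardinal.aleph 1 < boundingNumber := by
  by_contra hle
  obtain ⟨F, hF, hFcard⟩ := exists_mk_eq_boundingNumber
  have hFne : Nonempty F := by
    by_contra hemp
    exact hF ⟨0, fun f hf => absurd ⟨⟨f, hf⟩⟩ hemp⟩
  obtain ⟨ψ, hψ⟩ := exists_surjective_omega1 (hFcard.trans_le (not_lt.1 hle))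
  -- The maximum with `n` makes every `f α` eventually exceed each constant, so that `f β` dominates
  -- `q p` when `p.1 < β`.
  obtain ⟨f, hfm, hflt, hfψ⟩ := exists_monotone_scale fun α n => max ((ψ α).1 n) n
  have hunb : ¬ ∃ k, ∀ α, f α ≤ᶠ[atTop] k := fun ⟨k, hk⟩ => hF ⟨fun n => k n + 1, fun g hg => by
    obtain ⟨α, hα⟩ := hψ ⟨g, hg⟩
    refine eventuallyLess_succ (EventuallyLE.trans ?_ ((hfψ α).trans (hk α)))
    exact Eventually.of_forall fun n => hα ▸ le_max_left _ _⟩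
  let q : Omega1 × ℕ → ℕ → ℕ := fun p n => max (f p.1 n) p.2
  have hqm : ∀ p, Monotone (q p) := fun p => (hfm p.1).max monotone_const
  have hfq : ∀ p, f p.1 ≤ᶠ[atTop] q p := fun p => Eventually.of_forall fun n => le_max_left _ _
  have hqle : ∀ p β, p.1 < β → ∃ N, q p ≤ q (β, N) := fun p β hlt => by
    obtain ⟨k, hk⟩ := eventually_atTop.1 (hflt _ _ hlt)
    refine ⟨max p.2 (f p.1 k), fun n => max_le ?_ (le_max_of_le_right (le_max_left _ _))⟩
    rcases le_total k n with hn | hn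
    · exact le_max_of_le_left (hk n hn)
    · exact le_max_of_le_right (le_max_of_le_right (hfm _ hn))
  have hgt : ∀ A : Set Omega1, A.Countable → ∃ β, ∀ α ∈ A, α < β := fun A hA => by
    obtain ⟨b, hb⟩ := bddAbove_omega1_iff.2 hA
    obtain ⟨β, hβ⟩ : ∃ β, β ∉ Iic b :=
      (ne_univ_iff_exists_notMem _).1 fun h => not_countable_univ (h ▸ countable_Iic_omega1 b)
    exact ⟨β, fun α hα => (hb hα).trans_lt (not_le.1 hβ)⟩
  -- Only countably many `q p` have `p.1 < β`; all the others are eventually above `f β`.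
  have hcof : ∀ Y ⊆ range q, ¬ Y.Countable → ∀ β, ¬ {g ∈ Y | f β ≤ᶠ[atTop] g}.Countable := by
    intro Y hYq hY β hc
    have : Countable (Iio β) := (countable_Iio_omega1 β).to_subtype
    refine hY (Countable.mono ?_ (hc.union (countable_range fun p : Iio β × ℕ => q (p.1, p.2))))
    intro g hg
    obtain ⟨p, rfl⟩ := hYq hg
    rcases lt_trichotomy p.1 β with hlt | heq | hlt
    · exact Or.inr ⟨(⟨p.1, hlt⟩, p.2), rfl⟩
    · exact Or.inl ⟨hg, heq ▸ hfq p⟩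
    · exact Or.inl ⟨hg, (hflt _ _ hlt).trans (hfq p)⟩
  have hYunb : ∀ Y ⊆ range q, ¬ Y.Countable → ¬ ∃ k, ∀ g ∈ Y, g ≤ᶠ[atTop] k := by
    rintro Y hYq hY ⟨k, hk⟩
    refine hunb ⟨k, fun β => ?_⟩
    obtain ⟨g, hg⟩ : {g ∈ Y | f β ≤ᶠ[atTop] g}.Nonempty := by
      by_contra hemp
      rw [not_nonempty_iff_eq_empty] at hemp
      exact hcof Y hYq hY β (hemp ▸ countable_empty)
    exact hg.2.trans (hk g hg.1)
  have hrange : ¬ (range q).Countable := fun hc => by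
    obtain ⟨g, -, hg⟩ := exists_monotone_eventually_ge hc
    exact hunb ⟨g, fun α => (hfq (α, 0)).trans (hg _ (mem_range_self _))⟩
  have hdir : IsDirectedOrder (range q) := ⟨by
    rintro ⟨_, p, rfl⟩ ⟨_, p', rfl⟩
    obtain ⟨β, hβ⟩ := hgt {p.1, p'.1} (Set.toFinite _).countable
    obtain ⟨N, hN⟩ := hqle p β (hβ _ (by simp))
    obtain ⟨N', hN'⟩ := hqle p' β (hβ _ (by simp))
    refine ⟨⟨_, (β, max N N'), rfl⟩, hN.trans fun n => ?_, hN'.trans fun n => ?_⟩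
    · exact max_le_max le_rfl (le_max_left _ _)
    · exact max_le_max le_rfl (le_max_right _ _)⟩
  have hcard : Cardinal.mk (range q) ≤ Cardinal.aleph 1 := by
    refine Cardinal.mk_range_le.trans ?_
    rw [Cardinal.mk_prod, mk_omega1]
    simp
  obtain ⟨P, hPu, hP⟩ := h.exists_cover hcard fun Y hY => by
    let X : Set (ℕ → ℕ) := Subtype.val '' Y
    have hXq : X ⊆ range q := by
      rintro _ ⟨g, -, rfl⟩
      exact g.2
    have hX : ¬ X.Countable := fun hc =>
      hY (countable_of_injective_of_countable_image Subtype.val_injective.injOn hc)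
    obtain ⟨E, hEX, hEc, hE⟩ := exists_countable_dense X
    choose! a ha using fun g (hg : g ∈ range q) => hg
    obtain ⟨β, hβ⟩ := hgt ((fun g => (a g).1) '' E) (hEc.image _)
    have hEβ : ∀ g ∈ E, g ≤ᶠ[atTop] f β := fun g hg => by
      obtain ⟨n, hn⟩ := eventually_atTop.1
        ((hflt _ _ (hβ _ (mem_image_of_mem _ hg))).and (hfψ β))
      refine eventually_atTop.2 ⟨max n (a g).2, fun k hk => ?_⟩
      obtain ⟨h₁, h₂⟩ := hn k ((le_max_left _ _).trans hk)
      rw [← ha g (hXq (hEX hg))]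
      exact max_le h₁ (((le_max_right _ _).trans hk).trans ((le_max_right _ _).trans h₂))
    have hXE : ¬ (X \ E).Countable := fun hc =>
      hX ((hc.union hEc).mono fun g hg => by
        by_cases hgE : g ∈ E
        · exact Or.inr hgE
        · exact Or.inl ⟨hg, hgE⟩)
    obtain ⟨g, hg, hgi⟩ := exists_infinite_le_of_unbounded
      (fun g hg => by obtain ⟨p, rfl⟩ := hXq hg; exact hqm p) hEX hE hEβ
      (Y := {g ∈ X \ E | f β ≤ᶠ[atTop] g}) (fun g hg => hg.1) (fun g hg => hg.2)
      (hYunb _ (fun g hg => hXq hg.1.1) (hcof _ (fun g hg => hXq hg.1) hXE β))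
    refine ⟨Subtype.val ⁻¹' {f ∈ E | f ≤ g}, fun f hf => ?_, fun hf => hgi ?_,
      ⟨g, hXq hg.1.1⟩, fun f hf => hf.2⟩
    · obtain ⟨f', hf', hff'⟩ := hEX hf.1
      rwa [← Subtype.val_injective hff']
    · refine (hf.image Subtype.val).subset fun f hf => ?_
      exact ⟨⟨f, hXq (hEX hf.1)⟩, hf, rfl⟩
  obtain ⟨n, hn⟩ : ∃ n, ¬ (Subtype.val '' P n).Countable := by
    by_contra hc
    push Not at hc
    refine hrange ((countable_iUnion hc).mono fun g hg => ?_)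
    obtain ⟨n, hn⟩ := mem_iUnion.1 (hPu ▸ mem_univ (⟨g, hg⟩ : range q))
    exact mem_iUnion.2 ⟨n, _, hn, rfl⟩
  have hPq : Subtype.val '' P n ⊆ range q := by
    rintro _ ⟨g, -, rfl⟩
    exact g.2
  obtain ⟨E, hEX, hEc, hE⟩ := exists_countable_dense (Subtype.val '' P n)
  obtain ⟨b, hb⟩ := hP n (Subtype.val ⁻¹' E)
    (fun g hg => by
      obtain ⟨g', hg', h'⟩ := hEX hg
      rwa [← Subtype.val_injective h'])
    (hEc.preimage Subtype.val_injective)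
  refine hYunb _ hPq hn ⟨b, fun g hg => Eventually.of_forall fun k => ?_⟩
  obtain ⟨e, he, heg⟩ := hE g hg (k + 1)
  rw [← heg k (Nat.lt_succ_self k)]
  exact hb (show (⟨e, hPq (hEX he)⟩ : range q) ∈ Subtype.val ⁻¹' E from he) k

end FiveTypes

theorem mainTheorem1 (hPID : FiveTypes.PID.{u}) :
    Cardinal.aleph 1 < min FiveTypes.boundingNumber FiveTypes.cofFSigma ↔
      FiveTypes.OnlyFiveCofinalTypes.{v} :=
  ⟨FiveTypes.onlyFiveCofinalTypes_of_lt hPID,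
    fun h => lt_min h.lt_boundingNumber h.lt_cofFSigma⟩
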